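/- Let $\mathcal E$ be a Euclidean space, let $\mathcal M_1,\mathcal M_2\subset\mathcal E$ be $C^2$ embedded submanifolds, $\mathcal M=\mathcal M_1\cap\mathcal M_2$ and $\bar x\in\mathcal M$. Let $U$ be an open neighbourhood of $\bar x$ and $H:\mathcal E\to\mathbb R^m$ a map that is $C^2$ on $U$ with $\mathcal M_2\cap U=\{z\in U: H(z)=0\}$ and $\mathrm DH(z)$ surjective for $z\in U$. Assume the nondegeneracy condition $\mathrm DH(x)\,\mathrm T_x\mathcal M_1=\mathbb R^m$ for all $x\in\mathcal M\cap U$. Let $Q$ be a projective mapping for $\mathcal M_1$ on $U$: it assigns to each $z$ a linear operator $Q(z)$ on $\mathcal E$, is continuous on $\mathcal M_1\cap U$, and for $z\in\mathcal M_1\cap U$ the operator $Q(z)$ is symmetric positive semidefinite with $\ker Q(z)=\mathrm N_z\mathcal M_1=(\mathrm T_z\mathcal M_1)^\perp$. Let $\tau,\xi:\mathcal E\to[0,\infty)$ (a regularization parameter and an error tolerance) be bounded on $\mathcal M_1\cap U$, and put \[ A(z)=z-Q(z)d(z),\qquad d(z)=\mathrm DH(z)^*\bigl(\mathrm DH(z)Q(z)\mathrm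 DH(z)^*+\tau(z)I\bigr)^{-1}H(z). \] (Where the matrix in parentheses is singular, which does not happen on $\mathcal M_1$ near $\bar x$, its inverse is read as $0$.) For a point $y$ let $\Pi_{\mathcal M_1}(y)$ be the set of points of $\mathcal M_1$ nearest to $y$. An APHL sequence started from $P_{\mathcal M_1}(y)$ is a sequence $(z_k)$ with $z_0\in\Pi_{\mathcal M_1}(y)$ and, for all $k\ge 0$, \[ z_{k+1}\in\Pi_{\mathcal M_1}\bigl(A(z_k)+r_k\bigr),\qquad \|r_k\|\le\xi(z_k)\|H(z_k)\|^2 . \] Then there is a neighbourhood $W$ of $\bar x$ such that for every $x\in\mathcal M\cap W$ the following hold. 1. There are $\delta>0$ and $C$ such that for every $\eta\in \mathrm T_x\mathcal M$ with $\|\eta\|<\delta$: the projection $P_{\mathcal M_1}(x+\eta)$ exists and is unique; for every admissible error rule (maps $\rho_k:\mathcal E\to\mathcal E$ with $\|\rho_k(z)\|\le\xi(z)\|H(z)\|^2$ for $z\in\mathcal M_1$) there is an APHL sequence started from $P_{\mathcal M_1}(x+\eta)$ with $r_k=\rho_k(z_k)$; and every APHL sequence started from $P_{\mathcal M_1}(x+\eta)$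 converges to some $z^*\in\mathcal M$, with \[ \|z^*-(x+\eta)\|\le C\|\eta\|^2 . \] 2. Let $\Phi_x:\mathcal E\to\mathcal E$ be any map such that, for all sufficiently small $\eta\in\mathrm T_x\mathcal M$, $\Phi_x(\eta)$ is the limit of an APHL sequence started from $P_{\mathcal M_1}(x+\eta)$. Then $\Phi_x(\eta)=x+\eta+O(\|\eta\|^2)$ as $\eta\to0$ in $\mathrm T_x\mathcal M$; in particular $\Phi_x$ satisfies the first-order retraction expansion: for every $\eta\in \mathrm T_x\mathcal M$, $\Phi_x(t\eta)=x+t\eta+o(t)$ as $t\to0$. -/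

import Mathlib

open Filter Topology Asymptotics
open scoped NNReal

noncomputable section

variable {E : Type*} [NormedAddCommGroup E] [InnerProductSpace ℝ E]

/-- A `C²` embedded submanifold of the Euclidean space `E`: a nonempty set which, for a fixed
codimension `m`, has near each of its points `x` a `C²` local defining function `h` with values
in `ℝᵐ` whose differential at `x` is onto (for `m = 0` this says that the set is open). -/
def IsC2Submanifold (S : Set E) : Prop :=
  S.Nonempty ∧ ∃ m : ℕ, ∀ x ∈ S, ∃ U : Set E, IsOpen U ∧ x ∈ U ∧
    ∃ h : E → EuclideanSpace ℝ (Fin m), ContDiffOn ℝ 2 h U ∧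
      (∀ y ∈ U, h y = 0 ↔ y ∈ S) ∧ Function.Surjective (fderiv ℝ h x)

/-- The tangent space of `S` at `x`: the velocities at time `0` of the curves in `S` through `x`.
(For an embedded submanifold these already form a linear subspace.) -/
def tangentSpaceAt (S : Set E) (x : E) : Submodule ℝ E :=
  Submodule.span ℝ {v | ∃ γ : ℝ → E, γ 0 = x ∧ (∀ᶠ t in 𝓝 (0 : ℝ), γ t ∈ S) ∧ HasDerivAt γ v 0}

/-- The (a priori set-valued) orthogonal projection of `y` onto `S`. -/
def projSet (S : Set E) (y : E) : Set E :=
  {p | p ∈ S ∧ ∀ q ∈ S, ‖p - y‖ ≤ ‖q - y‖}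

/-- `Q` is a projective mapping for `S` on `U`: at the points `z` of `S ∩ U` it depends
continuously on `z`, it is symmetric positive semidefinite, and its kernel is the normal space
of `S` at `z`. -/
def IsProjectiveMappingOn (S : Set E) (Q : E → E →L[ℝ] E) (U : Set E) : Prop :=
  ContinuousOn Q (S ∩ U) ∧ ∀ z ∈ S ∩ U, (Q z).IsPositive ∧
    LinearMap.ker (Q z : E →ₗ[ℝ] E) = (tangentSpaceAt S z)ᗮ

variable [FiniteDimensional ℝ E] {m : ℕ}

/-- The adjoint `DH(z)*` of the differential of `H` at `z`. -/
def adjointDeriv (H : E → EuclideanSpace ℝ (Fin m)) (z : E) : EuclideanSpace ℝ (Fin m) →L[ℝ] E :=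
  haveI : CompleteSpace E := FiniteDimensional.complete ℝ E
  ContinuousLinearMap.adjoint (fderiv ℝ H z)

/-- The `m × m` system matrix `DH(z) Q(z) DH(z)* + τ(z) I`. -/
def aphlSystem (H : E → EuclideanSpace ℝ (Fin m)) (Q : E → E →L[ℝ] E) (τ : E → ℝ≥0) (z : E) :
    EuclideanSpace ℝ (Fin m) →L[ℝ] EuclideanSpace ℝ (Fin m) :=
  (fderiv ℝ H z).comp ((Q z).comp (adjointDeriv H z)) +
    (τ z : ℝ) • ContinuousLinearMap.id ℝ (EuclideanSpace ℝ (Fin m))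

/-- The direction `d(z) = DH(z)* (DH(z) Q(z) DH(z)* + τ(z) I)⁻¹ H(z)`. -/
def aphlDirection (H : E → EuclideanSpace ℝ (Fin m)) (Q : E → E →L[ℝ] E) (τ : E → ℝ≥0) (z : E) :
    E :=
  adjointDeriv H z (Ring.inverse (aphlSystem H Q τ z) (H z))

/-- The constraint-dissolving correction `A(z) = z - Q(z) d(z)`. -/
def aphlCorrection (H : E → EuclideanSpace ℝ (Fin m)) (Q : E → E →L[ℝ] E) (τ : E → ℝ≥0) (z : E) :
    E :=
  z - Q z (aphlDirection H Q τ z)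

/-- `z` is an APHL sequence with errors `r`, started at a projection of `y` onto `M₁`:
`z₀ ∈ Π(y)`, `zₖ₊₁ ∈ Π(A(zₖ) + rₖ)` and `‖rₖ‖ ≤ ξ(zₖ) ‖H(zₖ)‖²`,
where `Π` is the projection onto `M₁`. -/
def IsAPHLSequence (M₁ : Set E) (H : E → EuclideanSpace ℝ (Fin m)) (Q : E → E →L[ℝ] E)
    (τ ξ : E → ℝ≥0) (y : E) (z r : ℕ → E) : Prop :=
  z 0 ∈ projSet M₁ y ∧
    ∀ k, ‖r k‖ ≤ ξ (z k) * ‖H (z k)‖ ^ 2 ∧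
      z (k + 1) ∈ projSet M₁ (aphlCorrection H Q τ (z k) + r k)

/-- `w` is the limit of some APHL sequence started at a projection of `y` onto `M₁`. -/
def IsAPHLLimit (M₁ : Set E) (H : E → EuclideanSpace ℝ (Fin m)) (Q : E → E →L[ℝ] E)
    (τ ξ : E → ℝ≥0) (y w : E) : Prop :=
  ∃ z r : ℕ → E, IsAPHLSequence M₁ H Q τ ξ y z r ∧ Tendsto z atTop (𝓝 w)

end

/-! ### Taylor bound and metric regularity near a point. -/

section LocalEstimates

variable {E F : Type*} [NormedAddCommGroup E] [NormedSpace ℝ E] [NormedAddCommGroup F]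
  [NormedSpace ℝ F]

/-! On `M₁` near x the correction is a regularized Gauss–Newton step for H = 0. It is tangent to
`M₁`, since the range of Q(z) is orthogonal to its kernel, the normal space; hence projecting back
costs only O(‖H‖²), the order of the allowed error. Nondegeneracy makes DH Q DH* uniformly coercive,
so the step has length O(‖H‖) and its linearized residual τw is at most a fixed fraction of ‖H‖.
Each iteration therefore moves O(‖H‖) and shrinks ‖H‖ by a factor θ < 1 (`exists_aphl_step_bound`),
and a geometric series bounds the whole path by O(‖H(z₀)‖) (`exists_tendsto_of_step_bound`).

For η tangent to the intersection, DH(x)η = 0 and z₀ is within O(‖η‖²) of x + η. So ‖H(z₀)‖ =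
O(‖η‖²), and the limit is second-order close to x + η (`exists_aphl_convergence`). These bounds hold
for every choice of nearest points; uniqueness of the projection serves only the claim about the
starting point. -/

omit [NormedSpace ℝ E] in
theorem eventually_pos_ball_subset {x : E} {t : Set E} (ht : t ∈ 𝓝 x) :
    ∀ᶠ r in 𝓝[>] (0 : ℝ), Metric.ball x r ⊆ t :=
  (eventually_ball_subset ht).filter_mono nhdsWithin_le_nhds

/-- The first-order Taylor estimate with quadratic remainder, uniformly near a `C²` point. -/
theorem ContDiffAt.exists_taylor_bound {h : E → F} {x : E} (hh : ContDiffAt ℝ 2 h x) :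
    ∃ L : ℝ, 0 ≤ L ∧ ∀ᶠ r in 𝓝[>] (0 : ℝ), ∀ y ∈ Metric.ball x r, ∀ z ∈ Metric.ball x r,
      ‖h y - h z - fderiv ℝ h z (y - z)‖ ≤ L * ‖y - z‖ ^ 2 := by
  have h1 : ContDiffAt ℝ 1 (fderiv ℝ h) x := hh.fderiv_right (by norm_num)
  obtain ⟨K, t, ht, hK⟩ := h1.exists_lipschitzOnWith
  have hd : ∀ᶠ y in 𝓝 x, DifferentiableAt ℝ h y := by
    filter_upwards [hh.eventually (by simp)] with y hy
    exact hy.differentiableAt (by norm_num)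
  refine ⟨K, K.2, ?_⟩
  filter_upwards [eventually_pos_ball_subset ht, eventually_pos_ball_subset hd] with r hrt hrd y hy z hz
  have hseg : segment ℝ z y ⊆ Metric.ball x r := (convex_ball x r).segment_subset hz hy
  have := (convex_segment (𝕜 := ℝ) z y).norm_image_sub_le_of_norm_fderiv_le'
    (f := h) (φ := fderiv ℝ h z) (C := K * ‖y - z‖)
    (fun w hw => hrd (hseg hw)) (fun w hw => by
      have h2 := hK.norm_sub_le (hrt (hseg hw)) (hrt hz)
      refine h2.trans ?_
      gcongr
      simpa using norm_sub_le_of_mem_segment hw)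
    (left_mem_segment ℝ z y) (right_mem_segment ℝ z y)
  calc _ ≤ _ := this
    _ = _ := by ring

/-- Metric regularity: near a point where the strict derivative is onto, the zero set is at
distance `O(‖h y‖)` from `y`. -/
theorem HasStrictFDerivAt.exists_zero_near [CompleteSpace E] [CompleteSpace F] {h : E → F}
    {h' : E →L[ℝ] F} {x : E}
    (hh : HasStrictFDerivAt h h' x) (hsurj : Function.Surjective h') (hx : h x = 0) {V : Set E}
    (hV : V ∈ 𝓝 x) :
    ∃ C : ℝ, 0 ≤ C ∧ ∀ᶠ r in 𝓝[>] (0 : ℝ), ∀ y ∈ Metric.ball x r,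
      ∃ q ∈ V, h q = 0 ∧ ‖q - y‖ ≤ C * ‖h y‖ := by
  have hr : h'.range = ⊤ := LinearMap.range_eq_top.2 hsurj
  let g := h'.nonlinearRightInverseOfSurjective hr
  have gpos : 0 < g.nnnorm := h'.nonlinearRightInverseOfSurjective_nnnorm_pos hr
  -- With half of the critical constant, the image of a ball of radius ε about y covers the ball of
  -- radius (‖g‖⁻¹ - c)ε = cε about h y; ε = c⁻¹‖h y‖ just reaches 0.
  set c : ℝ≥0 := g.nnnorm⁻¹ / 2 with hc
  have cpos : 0 < c := by simp [hc, gpos]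
  obtain ⟨s, hs, happ⟩ := hh.approximates_deriv_on_nhds (Or.inr cpos)
  obtain ⟨ε, hε, hball⟩ := Metric.mem_nhds_iff.1 (inter_mem hs hV)
  have hsmall : ∀ᶠ y in 𝓝 x, (c : ℝ)⁻¹ * ‖h y‖ < ε / 2 := by
    have : Tendsto (fun y => (c : ℝ)⁻¹ * ‖h y‖) (𝓝 x) (𝓝 ((c : ℝ)⁻¹ * ‖h x‖)) :=
      (hh.continuousAt.norm).const_mul _
    rw [hx] at this
    exact this.eventually_lt_const (by simpa using half_pos hε)
  refine ⟨(c : ℝ)⁻¹, by positivity, ?_⟩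
  filter_upwards [eventually_pos_ball_subset hsmall,
    eventually_pos_ball_subset (Metric.ball_mem_nhds x (half_pos hε))] with r hr1 hr2 y hy
  have hsub : Metric.closedBall y ((c : ℝ)⁻¹ * ‖h y‖) ⊆ s ∩ V := fun q hq => hball <| by
    have h1 : (c : ℝ)⁻¹ * ‖h y‖ < ε / 2 := hr1 hy
    have h2 := hr2 hy
    rw [Metric.mem_ball] at h2 ⊢
    rw [Metric.mem_closedBall] at hq
    linarith [dist_triangle q y x]
  have hcc : ((g.nnnorm : ℝ)⁻¹ - c) = c := by
    rw [hc]; push_cast; ring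
  obtain ⟨q, hq, hq0⟩ := happ.surjOn_closedBall_of_nonlinearRightInverse g (by positivity)
    (fun q hq => (hsub hq).1) (show (0 : F) ∈ _ by
      rw [hcc, Metric.mem_closedBall, dist_zero_left, mul_inv_cancel_left₀ (by positivity)])
  exact ⟨q, (hsub hq).2, hq0, by simpa [dist_eq_norm] using hq⟩

end LocalEstimates

/-! ### Tangent vectors and nearest points of a submanifold. -/

section Submanifold

variable {E : Type*} [NormedAddCommGroup E] [InnerProductSpace ℝ E]

/-- Differentiate h ∘ γ = 0 along curves; the kernel is a subspace, so the span is covered. Only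
this inclusion is needed, never equality with the kernel. -/
theorem fderiv_apply_eq_zero_of_mem_tangentSpaceAt {F : Type*} [NormedAddCommGroup F]
    [NormedSpace ℝ F] {h : E → F} {S : Set E} {x v : E} (hh : DifferentiableAt ℝ h x)
    (hS : ∀ᶠ y in 𝓝 x, y ∈ S → h y = 0) (hv : v ∈ tangentSpaceAt S x) : fderiv ℝ h x v = 0 := by
  suffices tangentSpaceAt S x ≤ LinearMap.ker (fderiv ℝ h x : E →ₗ[ℝ] F) from this hv
  refine Submodule.span_le.2 ?_
  rintro v ⟨γ, rfl, hγS, hγ⟩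
  have h1 : HasDerivAt (h ∘ γ) (fderiv ℝ h (γ 0) v) 0 :=
    hh.hasFDerivAt.comp_hasDerivAt 0 hγ
  have h2 : (h ∘ γ) =ᶠ[𝓝 0] fun _ => 0 := by
    filter_upwards [hγS, hγ.continuousAt.eventually hS] with t h1 h2 using h2 h1
  exact h1.unique ((hasDerivAt_const 0 (0 : F)).congr_of_eventuallyEq h2)

theorem tangentSpaceAt_mono {S T : Set E} (hST : S ⊆ T) (x : E) :
    tangentSpaceAt S x ≤ tangentSpaceAt T x :=
  Submodule.span_mono fun _ ⟨γ, h0, hS, hd⟩ => ⟨γ, h0, hS.mono fun _ h => hST h, hd⟩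

omit [InnerProductSpace ℝ E] in
theorem norm_sub_le_of_mem_projSet {S : Set E} {x y p : E} (hx : x ∈ S) (hp : p ∈ projSet S y) :
    ‖p - x‖ ≤ 2 * ‖y - x‖ := by
  have h1 := hp.2 x hx
  have h2 := norm_sub_le_norm_sub_add_norm_sub p y x
  rw [norm_sub_rev x y] at h1
  linarith

/-- An embedded submanifold is locally closed. -/
theorem IsC2Submanifold.eventually_isClosed_inter_closedBall {S : Set E} (hS : IsC2Submanifold S)
    {x : E} (hx : x ∈ S) : ∀ᶠ r in 𝓝[>] (0 : ℝ), IsClosed (S ∩ Metric.closedBall x r) := by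
  obtain ⟨-, m, hm⟩ := hS
  obtain ⟨V, hV, hxV, h, hh, hhS, -⟩ := hm x hx
  obtain ⟨ε, hε, hball⟩ := Metric.isOpen_iff.1 hV x hxV
  filter_upwards [Ioo_mem_nhdsGT hε] with r hr
  have hsub : Metric.closedBall x r ⊆ V := (Metric.closedBall_subset_ball hr.2).trans hball
  have : S ∩ Metric.closedBall x r = Metric.closedBall x r ∩ h ⁻¹' {0} := by
    ext y
    constructor
    · exact fun ⟨h1, h2⟩ => ⟨h2, (hhS y (hsub h2)).2 h1⟩
    · exact fun ⟨h1, h2⟩ => ⟨(hhS y (hsub h1)).1 h2, h1⟩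
  rw [this]
  exact (hh.continuousOn.mono hsub).preimage_isClosed_of_isClosed Metric.isClosed_closedBall
    isClosed_singleton

variable [FiniteDimensional ℝ E]

/-- Points close to an embedded submanifold have a projection. -/
theorem IsC2Submanifold.eventually_projSet_nonempty {S : Set E} (hS : IsC2Submanifold S)
    {x : E} (hx : x ∈ S) : ∀ᶠ r in 𝓝[>] (0 : ℝ), ∀ y ∈ Metric.ball x r, (projSet S y).Nonempty := by
  obtain ⟨R, hR, hRpos⟩ := ((hS.eventually_isClosed_inter_closedBall hx).and
    self_mem_nhdsWithin).exists
  have hRpos : 0 < R := hRpos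
  filter_upwards [Ioo_mem_nhdsGT (half_pos hRpos)] with r hr y hy
  have hcomp : IsCompact (S ∩ Metric.closedBall x R) :=
    have : ProperSpace E := FiniteDimensional.proper ℝ E
    (isCompact_closedBall x R).of_isClosed_subset hR Set.inter_subset_right
  have hxR : x ∈ S ∩ Metric.closedBall x R := ⟨hx, by simp [hRpos.le]⟩
  obtain ⟨p, hp, hmin⟩ := hcomp.exists_isMinOn ⟨x, hxR⟩
    (f := fun q => ‖q - y‖) (by fun_prop)
  refine ⟨p, hp.1, fun q hq => ?_⟩
  -- As ‖y - x‖ < R/2, points outside the R-ball are farther from y than x is.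
  by_cases hqR : q ∈ Metric.closedBall x R
  · exact hmin ⟨hq, hqR⟩
  · have h1 : ‖p - y‖ ≤ ‖x - y‖ := hmin hxR
    rw [Metric.mem_closedBall, dist_eq_norm, not_le] at hqR
    rw [Metric.mem_ball, dist_eq_norm, norm_sub_rev] at hy
    have h2 := norm_sub_le_norm_sub_add_norm_sub q y x
    rw [norm_sub_rev y x] at h2
    linarith [hr.2]

/-- Points close to an embedded `C²` submanifold have exactly one projection. -/
theorem IsC2Submanifold.eventually_existsUnique_projSet {S : Set E} (hS : IsC2Submanifold S)
    {x : E} (hx : x ∈ S) : ∀ᶠ r in 𝓝[>] (0 : ℝ), ∀ y ∈ Metric.ball x r, ∃! p, p ∈ projSet S y := by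
  have hS' := hS
  obtain ⟨-, m, hm⟩ := hS'
  obtain ⟨V, hV, hxV, h, hh, hhS, hsurj⟩ := hm x hx
  have : CompleteSpace E := FiniteDimensional.complete ℝ E
  have hVx := hV.mem_nhds hxV
  have hC2 : ContDiffAt ℝ 2 h x := hh.contDiffAt hVx
  obtain ⟨C, hC, hCr⟩ := (hC2.hasStrictFDerivAt (by norm_num)).exists_zero_near hsurj
    ((hhS x hxV).2 hx) hVx
  obtain ⟨L, hL, hLr⟩ := hC2.exists_taylor_bound
  obtain ⟨r, ⟨⟨hr1, hr2⟩, hr3⟩, hr0⟩ := (((hCr.and hLr).and (eventually_pos_ball_subset hVx)).and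
    self_mem_nhdsWithin).exists
  have hr0 : 0 < r := hr0
  -- The first bound keeps all projections in the r-ball; the second makes 2CL‖p - y‖ < 1, which
  -- rules out two nearest points.
  have hεpos : 0 < min (r / 2) (1 / (2 * (C * L + 1))) := by positivity
  filter_upwards [hS.eventually_projSet_nonempty hx, Ioo_mem_nhdsGT hεpos] with ε hne hε y hy
  obtain ⟨p, hp⟩ := hne y hy
  refine ⟨p, hp, fun q hq => ?_⟩
  by_contra hqp
  rw [Metric.mem_ball, dist_eq_norm] at hy
  have hyr : 2 * ‖y - x‖ < r := by linarith [hε.2.trans_le (min_le_left _ _)]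
  have hpr : p ∈ Metric.ball x r := by
    rw [Metric.mem_ball, dist_eq_norm]; exact (norm_sub_le_of_mem_projSet hx hp).trans_lt hyr
  have hqr : q ∈ Metric.ball x r := by
    rw [Metric.mem_ball, dist_eq_norm]; exact (norm_sub_le_of_mem_projSet hx hq).trans_lt hyr
  -- Averaging the Taylor expansions at the midpoint cancels the linear terms, so w is within
  -- CL(D/2)² of `S`. By the parallelogram law ‖w - y‖² = ‖p - y‖² - (D/2)², so w is closer to y
  -- than p by more than that distance, contradicting minimality.
  set w : E := midpoint ℝ p q with hw
  have hwr : w ∈ Metric.ball x r := (convex_ball x r).midpoint_mem hpr hqr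
  set D := ‖p - q‖ with hD
  have hDpos : 0 < D := norm_pos_iff.2 (sub_ne_zero.2 (Ne.symm hqp))
  have hpw : p - w = (2 : ℝ)⁻¹ • (p - q) := by
    rw [hw, midpoint_eq_smul_add]; simp; module
  have hqw : q - w = -((2 : ℝ)⁻¹ • (p - q)) := by
    rw [hw, midpoint_eq_smul_add]; simp; module
  have hn : ‖(2 : ℝ)⁻¹‖ = 2⁻¹ := by norm_num
  set g := (2 : ℝ)⁻¹ • fderiv ℝ h w (p - q) with hg
  have e1 := hr2 p hpr w hwr
  have e2 := hr2 q hqr w hwr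
  rw [(hhS p (hr3 hpr)).2 hp.1, hpw, norm_smul, hn, map_smul, zero_sub, ← hg] at e1
  rw [(hhS q (hr3 hqr)).2 hq.1, hqw, norm_neg, norm_smul, hn, map_neg, map_smul, zero_sub,
    ← hg, sub_neg_eq_add] at e2
  have hhw : ‖h w‖ ≤ L * (D / 2) ^ 2 := by
    have e3 : h w = (2 : ℝ)⁻¹ • (-(-h w - g) + -(-h w + g)) := by module
    have e4 := norm_add_le (-(-h w - g)) (-(-h w + g))
    rw [norm_neg, norm_neg] at e4
    rw [e3, norm_smul, hn]
    have e5 : L * (D / 2) ^ 2 = L * (2⁻¹ * ‖p - q‖) ^ 2 := by rw [hD]; ring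
    linarith
  obtain ⟨s, hsV, hs0, hsw⟩ := hr1 w hwr
  have hsS : s ∈ S := (hhS s hsV).1 hs0
  have hps := hp.2 s hsS
  have hpq : ‖q - y‖ = ‖p - y‖ := le_antisymm (hq.2 p hp.1) (hp.2 q hq.1)
  have hpx : ‖p - y‖ ≤ ‖y - x‖ := by rw [norm_sub_rev y x]; exact hp.2 x hx
  have hpar := parallelogram_law_with_norm ℝ (p - y) (q - y)
  have ha : p - y + (q - y) = (2 : ℝ) • (w - y) := by
    rw [hw, midpoint_eq_smul_add]; simp; module
  have hb : p - y - (q - y) = p - q := by abel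
  rw [ha, hb, hpq, norm_smul] at hpar
  norm_num at hpar
  rw [← hD] at hpar
  have hsy := norm_sub_le_norm_sub_add_norm_sub s w y
  have hfin : ‖p - y‖ ≤ ‖w - y‖ + C * L * (D / 2) ^ 2 := by
    have : C * ‖h w‖ ≤ C * (L * (D / 2) ^ 2) := by gcongr
    linarith
  have hρ : 2 * (C * L + 1) * ‖p - y‖ < 1 := by
    have h1 : ‖p - y‖ < 1 / (2 * (C * L + 1)) :=
      (hpx.trans_lt hy).trans (hε.2.trans_le (min_le_right _ _))
    rw [lt_div_iff₀ (by positivity)] at h1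
    linarith
  have hwle : ‖w - y‖ ≤ ‖p - y‖ := by nlinarith [norm_nonneg (w - y), norm_nonneg (p - y)]
  have k1 : (‖p - y‖ - ‖w - y‖) * (‖p - y‖ + ‖w - y‖) = (D / 2) ^ 2 := by linarith
  have hD2 : 0 < (D / 2) ^ 2 := by positivity
  have k2 : (‖p - y‖ - ‖w - y‖) * (‖p - y‖ + ‖w - y‖) ≤
      C * L * (D / 2) ^ 2 * (2 * ‖p - y‖) :=
    mul_le_mul (by linarith) (by linarith) (by positivity) (by positivity)
  have hρ' : C * L * (2 * ‖p - y‖) < 1 := by linarith [norm_nonneg (p - y)]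
  rw [k1] at k2
  have k3 := mul_lt_mul_of_pos_right hρ' hD2
  linarith

/-- Small tangential displacements leave an embedded `C²` submanifold only to second order,
uniformly in the base point. -/
theorem IsC2Submanifold.exists_near_add_tangent {S : Set E} (hS : IsC2Submanifold S)
    {x : E} (hx : x ∈ S) : ∃ C : ℝ, 0 ≤ C ∧ ∀ᶠ r in 𝓝[>] (0 : ℝ), ∀ z ∈ S, ∀ v : E,
      z ∈ Metric.ball x r → v ∈ tangentSpaceAt S z → z + v ∈ Metric.ball x r →
        ∃ q ∈ S, ‖q - (z + v)‖ ≤ C * ‖v‖ ^ 2 := by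
  obtain ⟨-, m, hm⟩ := hS
  obtain ⟨V, hV, hxV, h, hh, hhS, hsurj⟩ := hm x hx
  have : CompleteSpace E := FiniteDimensional.complete ℝ E
  have hVx := hV.mem_nhds hxV
  have hC2 : ContDiffAt ℝ 2 h x := hh.contDiffAt hVx
  obtain ⟨C, hC, hCr⟩ := (hC2.hasStrictFDerivAt (by norm_num)).exists_zero_near hsurj
    ((hhS x hxV).2 hx) hVx
  obtain ⟨L, hL, hLr⟩ := hC2.exists_taylor_bound
  refine ⟨C * L, by positivity, ?_⟩
  filter_upwards [hCr, hLr, eventually_pos_ball_subset hVx] with r hr1 hr2 hr3 z hzS v hz hv hzv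
  obtain ⟨q, hqV, hq0, hq⟩ := hr1 _ hzv
  refine ⟨q, (hhS q hqV).1 hq0, hq.trans ?_⟩
  have hzV := hr3 hz
  have hd : DifferentiableAt ℝ h z :=
    (hh.contDiffAt (hV.mem_nhds hzV)).differentiableAt (by norm_num)
  have h0 : fderiv ℝ h z v = 0 := fderiv_apply_eq_zero_of_mem_tangentSpaceAt hd
    (by filter_upwards [hV.mem_nhds hzV] with y hy using (hhS y hy).2) hv
  have := hr2 _ hzv z hz
  rw [(hhS z hzV).2 hzS, add_sub_cancel_left, h0, sub_zero, sub_zero] at this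
  rw [mul_assoc]
  gcongr

end Submanifold

/-! ### Coercivity of the linear system and the one-step estimate. -/

section Algorithm

variable {E : Type*} [NormedAddCommGroup E] [InnerProductSpace ℝ E]

/-- The nonnegative quadratic form along v + t • T v has no constant term, so its discriminant (2‖T
v‖²)² must vanish. -/
theorem ContinuousLinearMap.IsPositive.apply_eq_zero {T : E →L[ℝ] E} (hT : T.IsPositive) {v : E}
    (hv : inner ℝ (T v) v = 0) : T v = 0 := by
  have h : ∀ t : ℝ, 0 ≤ inner ℝ (T (T v)) (T v) * (t * t) + 2 * inner ℝ (T v) (T v) * t + 0 := by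
    intro t
    have h1 := hT.inner_nonneg_left (v + t • T v)
    have h2 : inner ℝ (T (T v)) v = inner ℝ (T v) (T v) := hT.isSymmetric (T v) v
    simp only [map_add, map_smul, inner_add_left, inner_add_right, inner_smul_left,
      inner_smul_right, hv, h2, RCLike.conj_to_real] at h1
    linarith
  have h3 := discrim_le_zero h
  rw [discrim] at h3
  have h4 : inner ℝ (T v) (T v) = 0 := by
    nlinarith [sq_nonneg (inner ℝ (T v) (T v))]
  exact inner_self_eq_zero.1 h4

variable [FiniteDimensional ℝ E]

/-- By symmetry the range is orthogonal to the kernel, and Kᗮᗮ = K. This makes the correction step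
tangent. -/
theorem ContinuousLinearMap.IsPositive.apply_mem_of_ker_eq {T : E →L[ℝ] E} (hT : T.IsPositive)
    {K : Submodule ℝ E} (hK : LinearMap.ker (T : E →ₗ[ℝ] E) = Kᗮ) (v : E) : T v ∈ K := by
  rw [← K.orthogonal_orthogonal, Submodule.mem_orthogonal]
  intro u hu
  rw [← hK] at hu
  have h1 : T u = 0 := hu
  have h2 : inner ℝ (T u) v = inner ℝ u (T v) := hT.isSymmetric u v
  rw [← h2, h1, inner_zero_left]

variable {m : ℕ} {H : E → EuclideanSpace ℝ (Fin m)} {Q : E → E →L[ℝ] E}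

theorem inner_adjointDeriv_left (w : EuclideanSpace ℝ (Fin m)) (z v : E) :
    inner ℝ (adjointDeriv H z w) v = inner ℝ w (fderiv ℝ H z v) :=
  have : CompleteSpace E := FiniteDimensional.complete ℝ E
  ContinuousLinearMap.adjoint_inner_left _ _ _

theorem norm_adjointDeriv (z : E) : ‖adjointDeriv H z‖ = ‖fderiv ℝ H z‖ :=
  have : CompleteSpace E := FiniteDimensional.complete ℝ E
  LinearIsometryEquiv.norm_map ContinuousLinearMap.adjoint _

theorem continuousAt_adjointDeriv {x : E} (h : ContinuousAt (fderiv ℝ H) x) :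
    ContinuousAt (adjointDeriv H) x :=
  have : CompleteSpace E := FiniteDimensional.complete ℝ E
  (LinearIsometryEquiv.continuous (ContinuousLinearMap.adjoint (𝕜 := ℝ)
    (E := E) (F := EuclideanSpace ℝ (Fin m)))).continuousAt.comp h

/-- The unregularized system matrix `DH(z) Q(z) DH(z)*`. -/
noncomputable def aphlGram (H : E → EuclideanSpace ℝ (Fin m)) (Q : E → E →L[ℝ] E) (z : E) :
    EuclideanSpace ℝ (Fin m) →L[ℝ] EuclideanSpace ℝ (Fin m) :=
  (fderiv ℝ H z).comp ((Q z).comp (adjointDeriv H z))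

/-- Nondegeneracy makes `DH(x) Q(x) DH(x)*` positive definite. -/
theorem inner_aphlGram_pos {x : E} {K : Submodule ℝ E} (hQ : (Q x).IsPositive)
    (hker : LinearMap.ker (Q x : E →ₗ[ℝ] E) = Kᗮ)
    (hnd : K.map (fderiv ℝ H x : E →ₗ[ℝ] EuclideanSpace ℝ (Fin m)) = ⊤)
    {w : EuclideanSpace ℝ (Fin m)} (hw : w ≠ 0) : 0 < inner ℝ w (aphlGram H Q x w) := by
  have h1 : inner ℝ w (aphlGram H Q x w) =
      inner ℝ (adjointDeriv H x w) (Q x (adjointDeriv H x w)) :=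
    (inner_adjointDeriv_left w x _).symm
  rw [h1]
  refine lt_of_le_of_ne (hQ.inner_nonneg_right _) fun h0 => hw ?_
  have h2 : Q x (adjointDeriv H x w) = 0 :=
    hQ.apply_eq_zero (by rw [real_inner_comm]; exact h0.symm)
  have h3 : adjointDeriv H x w ∈ Kᗮ := by rw [← hker]; exact h2
  -- Writing w = DH u with u ∈ K gives ‖w‖² = ⟨DH* w, u⟩ = 0.
  obtain ⟨u, hu, huw⟩ : w ∈ K.map (fderiv ℝ H x : E →ₗ[ℝ] EuclideanSpace ℝ (Fin m)) := by
    rw [hnd]; trivial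
  have huw : fderiv ℝ H x u = w := huw
  have h4 := Submodule.inner_left_of_mem_orthogonal hu h3
  rw [inner_adjointDeriv_left, huw] at h4
  exact inner_self_eq_zero.1 h4

/-- The system matrix stays uniformly coercive near a nondegenerate point. -/
theorem eventually_coercive_aphlGram {x : E} {s : Set E}
    (hpos : ∀ w : EuclideanSpace ℝ (Fin m), w ≠ 0 → 0 < inner ℝ w (aphlGram H Q x w))
    (hQ : ContinuousWithinAt Q s x) (hH : ContinuousAt (fderiv ℝ H) x) :
    ∃ c : ℝ, 0 < c ∧ ∀ᶠ z in 𝓝[s] x, ∀ w, c * ‖w‖ ^ 2 ≤ inner ℝ w (aphlGram H Q z w) := by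
  -- This form also covers m = 0, where the sphere is empty. Half of c is spent on the perturbation
  -- from x to z.
  obtain ⟨c, hc, hcw⟩ := (isCompact_sphere (0 : EuclideanSpace ℝ (Fin m)) 1).exists_forall_le'
    (f := fun w => inner ℝ w (aphlGram H Q x w)) (by fun_prop) (a := 0) fun w hw =>
      hpos w (by rintro rfl; simp at hw)
  have hcont : ContinuousWithinAt (aphlGram H Q) s x :=
    hH.continuousWithinAt.clm_comp (hQ.clm_comp (continuousAt_adjointDeriv hH).continuousWithinAt)
  refine ⟨c / 2, half_pos hc, ?_⟩
  filter_upwards [hcont.eventually (Metric.ball_mem_nhds _ (half_pos hc))] with z hz w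
  rw [dist_eq_norm] at hz
  have h1 : c * ‖w‖ ^ 2 ≤ inner ℝ w (aphlGram H Q x w) := by
    rcases eq_or_ne w 0 with rfl | hw
    · simp
    · have hn : ‖w‖ ≠ 0 := norm_ne_zero_iff.2 hw
      have h2 := hcw (‖w‖⁻¹ • w) (by simp [norm_smul, hn])
      simp only [map_smul, inner_smul_left, inner_smul_right, RCLike.conj_to_real] at h2
      rw [← mul_assoc, ← mul_inv, ← sq, inv_mul_eq_div, le_div_iff₀ (by positivity)] at h2
      exact h2
  have h3 : |inner ℝ w ((aphlGram H Q z - aphlGram H Q x) w)| ≤ c / 2 * ‖w‖ ^ 2 := by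
    refine (abs_real_inner_le_norm _ _).trans ?_
    have h4 := (aphlGram H Q z - aphlGram H Q x).le_opNorm w
    calc ‖w‖ * ‖(aphlGram H Q z - aphlGram H Q x) w‖ ≤ ‖w‖ * (c / 2 * ‖w‖) := by
          gcongr; exact h4.trans (by gcongr)
      _ = _ := by ring
  have h5 := (abs_le.1 h3).1
  rw [sub_apply, inner_sub_right] at h5
  linarith

/-- Where the system is coercive, the correction is given by the solution of the linear system. -/
theorem exists_aphlCorrection_eq {z : E} {c : ℝ} (hc : 0 < c) (τ : E → ℝ≥0)
    (hco : ∀ w, c * ‖w‖ ^ 2 ≤ inner ℝ w (aphlGram H Q z w)) :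
    ∃ w, aphlCorrection H Q τ z = z - Q z (adjointDeriv H z w) ∧
      H z - fderiv ℝ H z (Q z (adjointDeriv H z w)) = (τ z : ℝ) • w ∧
      (c + τ z) * ‖w‖ ≤ ‖H z‖ := by
  have hlow : ∀ w, (c + τ z) * ‖w‖ ≤ ‖aphlSystem H Q τ z w‖ := by
    intro w
    rcases eq_or_ne w 0 with rfl | hw
    · simp
    have hn : 0 < ‖w‖ := norm_pos_iff.2 hw
    have h1 : aphlSystem H Q τ z w = aphlGram H Q z w + (τ z : ℝ) • w := rfl
    have h2 := real_inner_le_norm w (aphlSystem H Q τ z w)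
    rw [h1, inner_add_right, inner_smul_right, real_inner_self_eq_norm_sq, ← h1] at h2
    have h3 := hco w
    refine le_of_mul_le_mul_left ?_ hn
    linarith
  -- Invertibility ensures that `Ring.inverse` is not its default value 0.
  have hunit : IsUnit (aphlSystem H Q τ z) := by
    rw [ContinuousLinearMap.isUnit_iff_bijective]
    have hinj : Function.Injective (aphlSystem H Q τ z) := by
      rw [injective_iff_map_eq_zero]
      intro w hw
      have h1 := hlow w
      rw [hw, norm_zero] at h1
      have h2 : 0 < c + τ z := by positivity
      exact norm_le_zero_iff.1 (nonpos_of_mul_nonpos_right h1 h2)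
    exact ⟨hinj, (LinearMap.injective_iff_surjective
      (f := (aphlSystem H Q τ z).toLinearMap)).1 hinj⟩
  have hsol : aphlSystem H Q τ z (Ring.inverse (aphlSystem H Q τ z) (H z)) = H z :=
    DFunLike.congr_fun (Ring.mul_inverse_cancel _ hunit) (H z)
  refine ⟨Ring.inverse (aphlSystem H Q τ z) (H z), rfl, ?_, ?_⟩
  · rw [sub_eq_iff_eq_add']
    exact hsol.symm
  · simpa only [hsol] using hlow (Ring.inverse (aphlSystem H Q τ z) (H z))

variable {M₁ U : Set E} {τ ξ : E → ℝ≥0} {x : E}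

/-- One step of the algorithm near a nondegenerate point: the displacement is `O(‖H‖)`, and the
constraint violation is reduced by a fixed factor. -/
theorem exists_aphl_step_bound (hM₁ : IsC2Submanifold M₁) (hU : IsOpen U) (hx : x ∈ M₁)
    (hxU : x ∈ U) (hH : ContDiffOn ℝ 2 H U) (hHx : H x = 0)
    (hnd : (tangentSpaceAt M₁ x).map (fderiv ℝ H x : E →ₗ[ℝ] EuclideanSpace ℝ (Fin m)) = ⊤)
    (hQ : IsProjectiveMappingOn M₁ Q U) (hτ : ∃ B : ℝ≥0, ∀ z ∈ M₁ ∩ U, τ z ≤ B)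
    (hξ : ∃ B : ℝ≥0, ∀ z ∈ M₁ ∩ U, ξ z ≤ B) :
    ∃ K θ : ℝ, 0 ≤ K ∧ 0 ≤ θ ∧ θ < 1 ∧ ∀ᶠ r in 𝓝[>] (0 : ℝ), ∀ z ∈ M₁, z ∈ Metric.ball x r →
      ∀ e : E, ‖e‖ ≤ ξ z * ‖H z‖ ^ 2 →
        (projSet M₁ (aphlCorrection H Q τ z + e)).Nonempty ∧
        ∀ z' ∈ projSet M₁ (aphlCorrection H Q τ z + e),
          ‖z' - z‖ ≤ K * ‖H z‖ ∧ ‖H z'‖ ≤ θ * ‖H z‖ := by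
  obtain ⟨Bτ, hBτ⟩ := hτ
  obtain ⟨Bξ, hBξ⟩ := hξ
  have hUx := hU.mem_nhds hxU
  have hC2 : ContDiffAt ℝ 2 H x := hH.contDiffAt hUx
  have hDH : ContinuousAt (fderiv ℝ H) x :=
    (hC2.fderiv_right (m := 1) (by norm_num)).continuousAt
  have hQx := hQ.2 x ⟨hx, hxU⟩
  have hQc : ContinuousWithinAt Q (M₁ ∩ U) x := hQ.1 x ⟨hx, hxU⟩
  obtain ⟨c, hc, hco⟩ := eventually_coercive_aphlGram
    (fun w hw => inner_aphlGram_pos hQx.1 hQx.2 hnd hw) hQc hDH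
  set N : ℝ := max (‖fderiv ℝ H x‖ + 1) (‖Q x‖ + 1) with hN
  have hNpos : 0 < N := lt_max_of_lt_left (by positivity)
  have hDHN : ∀ᶠ z in 𝓝 x, ‖fderiv ℝ H z‖ < N :=
    hDH.norm.eventually_lt_const ((lt_add_one _).trans_le (le_max_left _ _))
  have hQN : ∀ᶠ z in 𝓝[M₁ ∩ U] x, ‖Q z‖ < N :=
    hQc.norm.eventually_lt_const ((lt_add_one _).trans_le (le_max_right _ _))
  obtain ⟨C, hC, hCr⟩ := hM₁.exists_near_add_tangent hx
  obtain ⟨L, hL, hLr⟩ := hC2.exists_taylor_bound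
  obtain ⟨R, ⟨⟨⟨⟨⟨hRC, hRL⟩, hRU⟩, hRDH⟩, hRQ⟩, hRne⟩, hR⟩ := ((((((hCr.and hLr).and
    (eventually_pos_ball_subset hUx)).and (eventually_pos_ball_subset hDHN)).and
    (eventually_pos_ball_subset (eventually_nhdsWithin_iff.1 (hco.and hQN)))).and
    (hM₁.eventually_projSet_nonempty hx)).and self_mem_nhdsWithin).exists
  have hR : 0 < R := hR
  -- With a = ‖H z‖: k·a bounds the tangential step, b·a² the distance from z' to z - u (the error e
  -- enters twice, in the target and in the comparison), and θ₀·a the residual τw.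
  set k : ℝ := N * (N * c⁻¹) with hk
  set b : ℝ := C * k ^ 2 + 2 * Bξ with hb
  set θ₀ : ℝ := Bτ / (c + Bτ) with hθ₀
  have hkpos : 0 ≤ k := by positivity
  have hbpos : 0 ≤ b := by positivity
  have hθ₀lt : θ₀ < 1 := by rw [hθ₀, div_lt_one (by positivity)]; linarith
  have hθ₀pos : 0 ≤ θ₀ := by positivity
  -- Respectively: a² ≤ a; the step stays in the R-ball; the quadratic terms fit between θ₀ and (1 +
  -- θ₀)/2.
  have hsmall : ∀ᶠ z in 𝓝 x, ‖H z‖ < 1 ∧ (k + b) * ‖H z‖ < R / 2 ∧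
      (N * b + L * (k + b) ^ 2) * ‖H z‖ < (1 - θ₀) / 2 := by
    have h0 : Tendsto (fun z => ‖H z‖) (𝓝 x) (𝓝 0) := by
      have := hC2.continuousAt.norm.tendsto
      rwa [hHx, norm_zero] at this
    have h1 : ∀ a : ℝ, Tendsto (fun z => a * ‖H z‖) (𝓝 x) (𝓝 0) := fun a => by
      simpa using h0.const_mul a
    exact (h0.eventually_lt_const one_pos).and (((h1 _).eventually_lt_const (by linarith)).and
      ((h1 _).eventually_lt_const (by linarith)))
  refine ⟨k + b, (1 + θ₀) / 2, by positivity, by positivity, by linarith, ?_⟩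
  filter_upwards [eventually_pos_ball_subset hsmall,
    eventually_pos_ball_subset (Metric.ball_mem_nhds x (half_pos hR))] with r hr1 hr2 z hzM hz e he
  obtain ⟨ha1, ha2, ha3⟩ := hr1 hz
  have hzR2 := hr2 hz
  rw [Metric.mem_ball, dist_eq_norm] at hzR2
  have hzR : z ∈ Metric.ball x R := by rw [Metric.mem_ball, dist_eq_norm]; linarith
  have hzU : z ∈ U := hRU hzR
  have hzDH : ‖fderiv ℝ H z‖ < N := hRDH hzR
  obtain ⟨hzco, hzQ⟩ := hRQ hzR ⟨hzM, hzU⟩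
  obtain ⟨hQpos, hQker⟩ := hQ.2 z ⟨hzM, hzU⟩
  obtain ⟨w, hA, hres, hw⟩ := exists_aphlCorrection_eq hc τ hzco
  set a := ‖H z‖ with ha
  have ha0 : 0 ≤ a := norm_nonneg _
  have haa : a ^ 2 ≤ a := by nlinarith
  set u : E := Q z (adjointDeriv H z w) with hu
  have hwa : ‖w‖ ≤ c⁻¹ * a := by
    rw [inv_mul_eq_div, le_div_iff₀ hc]
    have : 0 ≤ (τ z : ℝ) * ‖w‖ := by positivity
    linarith
  have huk : ‖u‖ ≤ k * a :=
    calc ‖u‖ ≤ ‖Q z‖ * (‖adjointDeriv H z‖ * ‖w‖) :=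
          (ContinuousLinearMap.le_opNorm _ _).trans (by gcongr; exact (adjointDeriv H z).le_opNorm w)
      _ ≤ N * (N * (c⁻¹ * a)) := by rw [norm_adjointDeriv]; gcongr
      _ = k * a := by rw [hk]; ring
  have hu_mem : -u ∈ tangentSpaceAt M₁ z := neg_mem (hQpos.apply_mem_of_ker_eq hQker _)
  have he' : ‖e‖ ≤ Bξ * a ^ 2 := he.trans (by gcongr; exact hBξ z ⟨hzM, hzU⟩)
  have heB : ‖e‖ ≤ Bξ * a := he'.trans (by gcongr)
  have hBb : (Bξ : ℝ) * a ≤ b * a := by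
    have : 0 ≤ C * k ^ 2 := by positivity
    have h2 : (0 : ℝ) ≤ Bξ := Bξ.2
    gcongr
    linarith
  have hba : 0 ≤ b * a := by positivity
  have hzu : z + -u ∈ Metric.ball x R := by
    rw [Metric.mem_ball, dist_eq_norm]
    have h1 : z + -u - x = (z - x) - u := by abel
    rw [h1]
    linarith [norm_sub_le (z - x) u]
  have hy : aphlCorrection H Q τ z + e ∈ Metric.ball x R := by
    rw [hA, Metric.mem_ball, dist_eq_norm]
    have h1 : z - u + e - x = (z - x) - (u - e) := by abel
    rw [h1]
    linarith [norm_sub_le (z - x) (u - e), norm_sub_le u e]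
  refine ⟨hRne _ hy, fun z' hz' => ?_⟩
  -- A competitor in `M₁` within O(‖u‖²) of z - u; z' is at least as close to the target.
  obtain ⟨q, hqM, hq⟩ := hRC z hzM (-u) hzR hu_mem hzu
  rw [norm_neg] at hq
  have hz'q := hz'.2 q hqM
  rw [hA] at hz'q
  have hu2 : C * ‖u‖ ^ 2 ≤ C * (k * a) ^ 2 := by gcongr
  have hz'u : ‖z' - (z - u)‖ ≤ b * a ^ 2 := by
    have h1 : z' - (z - u) = (z' - (z - u + e)) + e := by abel
    have h2 : q - (z - u + e) = (q - (z + -u)) - e := by abel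
    rw [h2] at hz'q
    rw [h1]
    have h3 := norm_add_le (z' - (z - u + e)) e
    have h4 := norm_sub_le (q - (z + -u)) e
    have h5 : b * a ^ 2 = C * (k * a) ^ 2 + Bξ * a ^ 2 + Bξ * a ^ 2 := by rw [hb]; ring
    linarith
  have hstep : ‖z' - z‖ ≤ (k + b) * a := by
    have h1 : z' - z = (z' - (z - u)) - u := by abel
    rw [h1]
    have h2 : b * a ^ 2 ≤ b * a := by gcongr
    linarith [norm_sub_le (z' - (z - u)) u]
  refine ⟨hstep, ?_⟩
  have hz'R : z' ∈ Metric.ball x R := by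
    rw [Metric.mem_ball, dist_eq_norm]
    linarith [norm_sub_le_norm_sub_add_norm_sub z' z x]
  have hT := hRL z' hz'R z hzR
  have hτw : ‖(τ z : ℝ) • w‖ ≤ θ₀ * a := by
    rw [norm_smul, Real.norm_of_nonneg (τ z).coe_nonneg, hθ₀, div_mul_eq_mul_div,
      le_div_iff₀ (by positivity)]
    have h1 : (τ z : ℝ) ≤ Bτ := hBτ z ⟨hzM, hzU⟩
    have h2 : 0 ≤ ‖w‖ := norm_nonneg w
    have h3 : (Bτ : ℝ) * ((c + τ z) * ‖w‖) ≤ Bτ * a := by gcongr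
    have h4 : (τ z : ℝ) * (c * ‖w‖) ≤ Bτ * (c * ‖w‖) := by gcongr
    linarith
  have hdecomp : H z' = (H z' - H z - fderiv ℝ H z (z' - z)) +
      fderiv ℝ H z (z' - (z - u)) + (τ z : ℝ) • w := by
    rw [← hres]
    simp only [map_sub]
    abel
  have hlin : ‖fderiv ℝ H z (z' - (z - u))‖ ≤ N * (b * a ^ 2) :=
    ((fderiv ℝ H z).le_opNorm _).trans (by gcongr)
  have hquad : L * ‖z' - z‖ ^ 2 ≤ L * ((k + b) * a) ^ 2 := by gcongr
  have hsum := norm_add₃_le (a := H z' - H z - fderiv ℝ H z (z' - z))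
    (b := fderiv ℝ H z (z' - (z - u))) (c := (τ z : ℝ) • w)
  rw [← hdecomp] at hsum
  have hlast : (N * b + L * (k + b) ^ 2) * a * a ≤ (1 - θ₀) / 2 * a := by gcongr
  linarith

end Algorithm

/-! ### Invariant region, convergence, and the second-order bound. -/

section Convergence

variable {E : Type*} [NormedAddCommGroup E] [InnerProductSpace ℝ E] [FiniteDimensional ℝ E]
  {m : ℕ} {H : E → EuclideanSpace ℝ (Fin m)} {Q : E → E →L[ℝ] E}
  {M₁ M₂ U : Set E} {τ ξ : E → ℝ≥0} {x : E}

/-- The points of `M₁` from which the iteration cannot leave the ball of radius `r`. -/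
def attractionSet (M₁ : Set E) (H : E → EuclideanSpace ℝ (Fin m)) (x : E) (K θ r : ℝ) : Set E :=
  {z | z ∈ M₁ ∧ ‖z - x‖ + K / (1 - θ) * ‖H z‖ < r}

omit [InnerProductSpace ℝ E] [FiniteDimensional ℝ E] in
theorem mem_ball_of_mem_attractionSet {K θ r : ℝ} (hK : 0 ≤ K) (hθ : θ < 1) {z : E}
    (hz : z ∈ attractionSet M₁ H x K θ r) : z ∈ Metric.ball x r := by
  rw [Metric.mem_ball, dist_eq_norm]
  have h1 : 0 ≤ K / (1 - θ) * ‖H z‖ := mul_nonneg (div_nonneg hK (by linarith)) (norm_nonneg _)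
  linarith [hz.2]

-- The term K/(1 - θ)·‖H z‖ bounds the remaining path length, Σ Kθʲ‖H z‖; one step uses up at least
-- the distance it travels.
omit [InnerProductSpace ℝ E] [FiniteDimensional ℝ E] in
theorem attractionSet_step {K θ r : ℝ} (hK : 0 ≤ K) (hθ : θ < 1) {z z' : E}
    (hz : z ∈ attractionSet M₁ H x K θ r) (hz' : z' ∈ M₁) (hstep : ‖z' - z‖ ≤ K * ‖H z‖)
    (hdec : ‖H z'‖ ≤ θ * ‖H z‖) : z' ∈ attractionSet M₁ H x K θ r := by
  refine ⟨hz', lt_of_le_of_lt ?_ hz.2⟩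
  have h0 : 0 < 1 - θ := by linarith
  have h1 : K / (1 - θ) * ‖H z'‖ ≤ K / (1 - θ) * (θ * ‖H z‖) := by gcongr
  have h2 : K / (1 - θ) * ‖H z‖ = K * ‖H z‖ + K / (1 - θ) * (θ * ‖H z‖) := by
    field_simp; ring
  linarith [norm_sub_le_norm_sub_add_norm_sub z' z x]

/-- A sequence with displacements `O(‖H‖)` and geometrically decreasing `‖H‖` converges to a zero
of `H`. -/
theorem exists_tendsto_of_step_bound {K θ : ℝ} (hK : 0 ≤ K) (hθ0 : 0 ≤ θ) (hθ : θ < 1) {z : ℕ → E}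
    (hstep : ∀ k, ‖z (k + 1) - z k‖ ≤ K * ‖H (z k)‖)
    (hdec : ∀ k, ‖H (z (k + 1))‖ ≤ θ * ‖H (z k)‖) :
    ∃ w, Tendsto z atTop (𝓝 w) ∧ ‖w - z 0‖ ≤ K / (1 - θ) * ‖H (z 0)‖ ∧
      Tendsto (fun k => H (z k)) atTop (𝓝 0) := by
  have : CompleteSpace E := FiniteDimensional.complete ℝ E
  have hgeo : ∀ k, ‖H (z k)‖ ≤ ‖H (z 0)‖ * θ ^ k := by
    intro k
    induction k with
    | zero => simp
    | succ k ih =>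
      calc ‖H (z (k + 1))‖ ≤ θ * ‖H (z k)‖ := hdec k
        _ ≤ θ * (‖H (z 0)‖ * θ ^ k) := by gcongr
        _ = _ := by ring
  have hdist : ∀ k, dist (z k) (z (k + 1)) ≤ K * ‖H (z 0)‖ * θ ^ k := fun k => by
    rw [dist_comm, dist_eq_norm, mul_assoc]
    exact (hstep k).trans (by gcongr; exact hgeo k)
  obtain ⟨w, hw⟩ := cauchySeq_tendsto_of_complete (cauchySeq_of_le_geometric θ _ hθ hdist)
  refine ⟨w, hw, ?_, ?_⟩
  · have := dist_le_of_le_geometric_of_tendsto₀ θ _ hθ hdist hw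
    rw [dist_comm, dist_eq_norm] at this
    exact this.trans_eq (by ring)
  · refine squeeze_zero_norm hgeo ?_
    simpa using (tendsto_pow_atTop_nhds_zero_of_lt_one hθ0 hθ).const_mul ‖H (z 0)‖

/-- Near a nondegenerate point of the intersection the algorithm is well defined and converges,
with a limit that is second-order close to its tangential starting point. -/
theorem exists_aphl_convergence (hM₁ : IsC2Submanifold M₁) (hU : IsOpen U)
    (hx : x ∈ M₁ ∩ M₂) (hxU : x ∈ U) (hH : ContDiffOn ℝ 2 H U) (hHM₂ : ∀ z ∈ U, H z = 0 ↔ z ∈ M₂)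
    (hnd : (tangentSpaceAt M₁ x).map (fderiv ℝ H x : E →ₗ[ℝ] EuclideanSpace ℝ (Fin m)) = ⊤)
    (hQ : IsProjectiveMappingOn M₁ Q U) (hτ : ∃ B : ℝ≥0, ∀ z ∈ M₁ ∩ U, τ z ≤ B)
    (hξ : ∃ B : ℝ≥0, ∀ z ∈ M₁ ∩ U, ξ z ≤ B) :
    ∃ δ > 0, ∃ C : ℝ, ∀ η ∈ tangentSpaceAt (M₁ ∩ M₂) x, ‖η‖ < δ →
      (∃! z₀, z₀ ∈ projSet M₁ (x + η)) ∧
      (∀ ρ : ℕ → E → E, (∀ k, ∀ z ∈ M₁, ‖ρ k z‖ ≤ ξ z * ‖H z‖ ^ 2) →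
        ∃ z : ℕ → E, IsAPHLSequence M₁ H Q τ ξ (x + η) z (fun k => ρ k (z k))) ∧
      (∀ z r : ℕ → E, IsAPHLSequence M₁ H Q τ ξ (x + η) z r →
        ∃ zstar ∈ M₁ ∩ M₂, Tendsto z atTop (𝓝 zstar) ∧
          ‖zstar - (x + η)‖ ≤ C * ‖η‖ ^ 2) := by
  have hUx := hU.mem_nhds hxU
  have hC2 : ContDiffAt ℝ 2 H x := hH.contDiffAt hUx
  have hHx : H x = 0 := (hHM₂ x hxU).2 hx.2
  obtain ⟨K, θ, hK, hθ0, hθ, hstep⟩ := exists_aphl_step_bound (τ := τ) (ξ := ξ) hM₁ hU hx.1 hxU hH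
    hHx hnd hQ hτ hξ
  obtain ⟨C, hC, hCr⟩ := hM₁.exists_near_add_tangent hx.1
  obtain ⟨L, hL, hLr⟩ := hC2.exists_taylor_bound
  obtain ⟨r, ⟨⟨⟨⟨⟨hrS, hrC⟩, hrL⟩, hrU⟩, hrcl⟩, hrP⟩, hr⟩ := ((((((hstep.and hCr).and hLr).and
    (eventually_pos_ball_subset hUx)).and (hM₁.eventually_isClosed_inter_closedBall hx.1)).and
    (hM₁.eventually_existsUnique_projSet hx.1)).and self_mem_nhdsWithin).exists
  have hr : 0 < r := hr
  -- `C₂`·‖η‖² will bound ‖H z₀‖: as DH(x)η = 0, the linear term sees only z₀ - (x + η), and 4L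
  -- comes from ‖z₀ - x‖ ≤ 2‖η‖.
  set C₂ : ℝ := ‖fderiv ℝ H x‖ * C + 4 * L with hC₂
  have hC₂0 : 0 ≤ C₂ := by positivity
  set K' : ℝ := K / (1 - θ) with hK'
  have hK'0 : 0 ≤ K' := div_nonneg hK (by linarith)
  refine ⟨min 1 (r / (2 + K' * C₂)), by positivity, C + K' * C₂, fun η hη hηδ => ?_⟩
  have hη1 : ‖η‖ < 1 := hηδ.trans_le (min_le_left _ _)
  have hηr : (2 + K' * C₂) * ‖η‖ < r := by
    have h := hηδ.trans_le (min_le_right _ _)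
    rw [lt_div_iff₀ (by positivity)] at h
    linarith
  have hη0 : 0 ≤ ‖η‖ := norm_nonneg η
  have hη2 : ‖η‖ ^ 2 ≤ ‖η‖ := by nlinarith
  have hKC : 0 ≤ K' * C₂ * ‖η‖ := by positivity
  have hxr : x ∈ Metric.ball x r := Metric.mem_ball_self hr
  have hyr : x + η ∈ Metric.ball x r := by
    rw [Metric.mem_ball, dist_eq_norm, add_sub_cancel_left]; linarith
  have hη_tan : η ∈ tangentSpaceAt M₁ x := tangentSpaceAt_mono Set.inter_subset_left x hη
  have hη_ker : fderiv ℝ H x η = 0 := fderiv_apply_eq_zero_of_mem_tangentSpaceAt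
    (hC2.differentiableAt (by norm_num))
    (by filter_upwards [hUx] with y hy hyM using (hHM₂ y hy).2 hyM.2) hη
  obtain ⟨q, hqM, hq⟩ := hrC x hx.1 η hxr hη_tan hyr
  have hstart : ∀ z₀ ∈ projSet M₁ (x + η), ‖z₀ - (x + η)‖ ≤ C * ‖η‖ ^ 2 ∧
      ‖H z₀‖ ≤ C₂ * ‖η‖ ^ 2 ∧ z₀ ∈ attractionSet M₁ H x K θ r := by
    intro z₀ hz₀
    have h1 : ‖z₀ - (x + η)‖ ≤ C * ‖η‖ ^ 2 := (hz₀.2 q hqM).trans hq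
    have h2 : ‖z₀ - x‖ ≤ 2 * ‖η‖ := by simpa using norm_sub_le_of_mem_projSet hx.1 hz₀
    have h3 := hrL z₀ (by rw [Metric.mem_ball, dist_eq_norm]; linarith) x hxr
    have h4 : fderiv ℝ H x (z₀ - x) = fderiv ℝ H x (z₀ - (x + η)) := by
      simp only [map_sub, map_add, hη_ker, add_zero]
    rw [hHx, sub_zero, h4] at h3
    have h5 : ‖fderiv ℝ H x (z₀ - (x + η))‖ ≤ ‖fderiv ℝ H x‖ * (C * ‖η‖ ^ 2) :=
      ((fderiv ℝ H x).le_opNorm _).trans (by gcongr)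
    have h6 : L * ‖z₀ - x‖ ^ 2 ≤ L * (2 * ‖η‖) ^ 2 := by gcongr
    have h7 : ‖H z₀‖ ≤ C₂ * ‖η‖ ^ 2 := by
      have h8 := norm_sub_norm_le (H z₀) (fderiv ℝ H x (z₀ - (x + η)))
      have h9 : C₂ * ‖η‖ ^ 2 = ‖fderiv ℝ H x‖ * (C * ‖η‖ ^ 2) + L * (2 * ‖η‖) ^ 2 := by
        rw [hC₂]; ring
      linarith
    refine ⟨h1, h7, hz₀.1, ?_⟩
    have h8 : K' * ‖H z₀‖ ≤ K' * (C₂ * ‖η‖) := by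
      gcongr
      exact h7.trans (by gcongr)
    linarith
  have hnext : ∀ z ∈ attractionSet M₁ H x K θ r, ∀ e : E, ‖e‖ ≤ ξ z * ‖H z‖ ^ 2 →
      (projSet M₁ (aphlCorrection H Q τ z + e)).Nonempty ∧
      ∀ z' ∈ projSet M₁ (aphlCorrection H Q τ z + e), z' ∈ attractionSet M₁ H x K θ r ∧
        ‖z' - z‖ ≤ K * ‖H z‖ ∧ ‖H z'‖ ≤ θ * ‖H z‖ := by
    intro z hz e he
    obtain ⟨h1, h2⟩ := hrS z hz.1 (mem_ball_of_mem_attractionSet hK hθ hz) e he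
    exact ⟨h1, fun z' hz' => ⟨attractionSet_step hK hθ hz hz'.1 (h2 z' hz').1 (h2 z' hz').2,
      h2 z' hz'⟩⟩
  refine ⟨hrP _ hyr, fun ρ hρ => ?_, fun z e hz => ?_⟩
  · obtain ⟨z₀, hz₀⟩ := (hrP _ hyr).exists
    -- The selector is total, so the recursion can be written first and invariance proved
    -- afterwards.
    choose! f hf using fun (k : ℕ) (z : E) (hz : z ∈ attractionSet M₁ H x K θ r) =>
      (hnext z hz (ρ k z) (hρ k z hz.1)).1
    let z : ℕ → E := fun n => Nat.rec z₀ (fun k z => f k z) n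
    have hz : ∀ k, z k ∈ attractionSet M₁ H x K θ r := by
      intro k
      induction k with
      | zero => exact (hstart z₀ hz₀).2.2
      | succ k ih => exact ((hnext _ ih _ (hρ k _ ih.1)).2 _ (hf k _ ih)).1
    exact ⟨z, hz₀, fun k => ⟨hρ k _ (hz k).1, hf k _ (hz k)⟩⟩
  · obtain ⟨hz0, hzs⟩ := hz
    obtain ⟨hs1, hs2, hs3⟩ := hstart _ hz0
    have hmem : ∀ k, z k ∈ attractionSet M₁ H x K θ r := by
      intro k
      induction k with
      | zero => exact hs3
      | succ k ih => exact ((hnext _ ih _ (hzs k).1).2 _ (hzs k).2).1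
    have hbd := fun k => ((hnext _ (hmem k) _ (hzs k).1).2 _ (hzs k).2).2
    obtain ⟨w, hw, hw0, hHw⟩ := exists_tendsto_of_step_bound hK hθ0 hθ
      (fun k => (hbd k).1) (fun k => (hbd k).2)
    have hwr : w ∈ Metric.ball x r := by
      rw [Metric.mem_ball, dist_eq_norm]
      linarith [norm_sub_le_norm_sub_add_norm_sub w (z 0) x, hs3.2]
    have hwU : w ∈ U := hrU hwr
    -- `M₁` is only locally closed, hence the intersection with the closed ball.
    have hwM : w ∈ M₁ := (hrcl.mem_of_tendsto hw (Eventually.of_forall fun k =>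
      ⟨(hmem k).1, Metric.ball_subset_closedBall (mem_ball_of_mem_attractionSet hK hθ (hmem k))⟩)).1
    have hHw0 : H w = 0 := tendsto_nhds_unique
      ((hH.contDiffAt (hU.mem_nhds hwU)).continuousAt.tendsto.comp hw) hHw
    refine ⟨w, ⟨hwM, (hHM₂ w hwU).1 hHw0⟩, hw, ?_⟩
    have h1 : K' * ‖H (z 0)‖ ≤ K' * (C₂ * ‖η‖ ^ 2) := by gcongr
    linarith [norm_sub_le_norm_sub_add_norm_sub w (z 0) (x + η)]

end Convergence

/-! ### Expansion of the limiting maps and conclusion. -/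

theorem isLittleO_sub_of_isBigO_sq {E : Type*} [NormedAddCommGroup E] [NormedSpace ℝ E]
    {T : Submodule ℝ E} {Φ : E → E} {x : E}
    (h : (fun η => Φ η - (x + η)) =O[𝓝[(T : Set E)] 0] fun η => ‖η‖ ^ 2) {η : E} (hη : η ∈ T) :
    (fun t : ℝ => Φ (t • η) - (x + t • η)) =o[𝓝 0] fun t : ℝ => t := by
  have htend : Tendsto (fun t : ℝ => t • η) (𝓝 0) (𝓝[(T : Set E)] 0) := by
    refine tendsto_nhdsWithin_iff.2 ⟨?_, Eventually.of_forall fun t => T.smul_mem t hη⟩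
    have : Continuous fun t : ℝ => t • η := by fun_prop
    simpa using this.tendsto 0
  refine (h.comp_tendsto htend).trans_isLittleO ?_
  have h1 : ((fun η : E => ‖η‖ ^ 2) ∘ fun t : ℝ => t • η) = fun t : ℝ => ‖η‖ ^ 2 * t ^ 2 := by
    funext t
    simp [norm_smul, mul_pow, mul_comm]
  rw [h1]
  exact (isLittleO_pow_id one_lt_two).const_mul_left _

theorem mainTheorem9 {E : Type*} [NormedAddCommGroup E] [InnerProductSpace ℝ E]
    [FiniteDimensional ℝ E] {m : ℕ}
    -- the two manifolds, a point of their intersection, and the local defining map of `M₂`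
    (M₁ M₂ : Set E) (hM₁ : IsC2Submanifold M₁) (hM₂ : IsC2Submanifold M₂)
    (xbar : E) (hxbar : xbar ∈ M₁ ∩ M₂)
    (U : Set E) (hU : IsOpen U) (hxU : xbar ∈ U)
    (H : E → EuclideanSpace ℝ (Fin m)) (hH : ContDiffOn ℝ 2 H U)
    (hHM₂ : ∀ z ∈ U, H z = 0 ↔ z ∈ M₂)
    (hHsurj : ∀ z ∈ U, Function.Surjective (fderiv ℝ H z))
    -- nondegeneracy
    (hnd : ∀ x ∈ M₁ ∩ M₂ ∩ U,
      (tangentSpaceAt M₁ x).map (fderiv ℝ H x : E →ₗ[ℝ] EuclideanSpace ℝ (Fin m)) = ⊤)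
    -- the data of the algorithm: projective mapping, regularization, error tolerance
    (Q : E → E →L[ℝ] E) (hQ : IsProjectiveMappingOn M₁ Q U)
    (τ ξ : E → ℝ≥0) (hτ : ∃ B : ℝ≥0, ∀ z ∈ M₁ ∩ U, τ z ≤ B)
    (hξ : ∃ B : ℝ≥0, ∀ z ∈ M₁ ∩ U, ξ z ≤ B) :
    ∃ W ∈ 𝓝 xbar, ∀ x ∈ M₁ ∩ M₂ ∩ W,
      -- for small tangent vectors the algorithm is well defined, every APHL sequence converges
      -- to a point of the intersection, and its limit is `x + η + O(‖η‖²)`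
      (∃ δ > 0, ∃ C : ℝ, ∀ η ∈ tangentSpaceAt (M₁ ∩ M₂) x, ‖η‖ < δ →
        (∃! z₀, z₀ ∈ projSet M₁ (x + η)) ∧
        (∀ ρ : ℕ → E → E, (∀ k, ∀ z ∈ M₁, ‖ρ k z‖ ≤ ξ z * ‖H z‖ ^ 2) →
          ∃ z : ℕ → E, IsAPHLSequence M₁ H Q τ ξ (x + η) z (fun k => ρ k (z k))) ∧
        (∀ z r : ℕ → E, IsAPHLSequence M₁ H Q τ ξ (x + η) z r →
          ∃ zstar ∈ M₁ ∩ M₂, Tendsto z atTop (𝓝 zstar) ∧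
            ‖zstar - (x + η)‖ ≤ C * ‖η‖ ^ 2)) ∧
      -- consequently every limiting map satisfies the first-order retraction expansion
      (∀ Φ : E → E,
        (∀ᶠ η in 𝓝[(tangentSpaceAt (M₁ ∩ M₂) x : Set E)] 0,
          IsAPHLLimit M₁ H Q τ ξ (x + η) (Φ η)) →
        ((fun η => Φ η - (x + η)) =O[𝓝[(tangentSpaceAt (M₁ ∩ M₂) x : Set E)] 0]
          fun η => ‖η‖ ^ 2) ∧
        ∀ η ∈ tangentSpaceAt (M₁ ∩ M₂) x,
          (fun t : ℝ => Φ (t • η) - (x + t • η)) =o[𝓝 0] fun t : ℝ => t) := by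
  -- U itself serves as the neighbourhood: the local hypotheses hold at each of its points in the
  -- intersection.
  refine ⟨U, hU.mem_nhds hxU, fun x hx => ?_⟩
  have hmain := exists_aphl_convergence hM₁ hU hx.1 hx.2 hH hHM₂ (hnd x hx) hQ hτ hξ
  refine ⟨hmain, fun Φ hΦ => ?_⟩
  suffices hO : (fun η => Φ η - (x + η)) =O[𝓝[(tangentSpaceAt (M₁ ∩ M₂) x : Set E)] 0]
      fun η => ‖η‖ ^ 2 from ⟨hO, fun η hη => isLittleO_sub_of_isBigO_sq hO hη⟩
  obtain ⟨δ, hδ, C, hC⟩ := hmain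
  refine IsBigO.of_bound C ?_
  filter_upwards [hΦ, self_mem_nhdsWithin,
    mem_nhdsWithin_of_mem_nhds (Metric.ball_mem_nhds (0 : E) hδ)] with η hlim hη hηδ
  obtain ⟨z, r, hz, hzlim⟩ := hlim
  obtain ⟨w, -, hw, hwC⟩ := (hC η hη (by simpa using hηδ)).2.2 z r hz
  rw [tendsto_nhds_unique hzlim hw, norm_pow, norm_norm]
  exact hwC
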